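/- Let $q\in\mathbb{R}$ and let $f:\,]0,1]\to\mathbb{R}$ satisfy $$f(xy)+f((1-x)y)-f(y)=\bigl(f(x)+f(1-x)\bigr)y^{q}\qquad\text{for all } x\in\,]0,1[,\ y\in\,]0,1].$$ 1. Suppose $q\neq 1$, and that $f$ is bounded above or bounded below on some Lebesgue measurable subset of $]0,1[$ of positive Lebesgue measure, or that $f$ is Lebesgue measurable. Then there exist $c,c^{*}\in\mathbb{R}$ such that $f(x)=c^{*}x+c\,x^{q}$ for all $x\in\,]0,1[$, and $f(1)=0$. 2. Suppose $q=1$, and that $f$ is bounded (both above and below) on some Lebesgue measurable subset of $]0,1[$ of positive Lebesgue measure, or that $f$ is Lebesgue measurable. Then there exist $c,c^{*}\in\mathbb{R}$ such that $f(x)=c\,x\ln x+c^{*}x$ for all $x\in\,]0,1[$, and $f(1)=0$. -/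

import Mathlib

open MeasureTheory

/-- `f` (of which only the values on `]0, 1]` matter) satisfies
`f(xy) + f((1-x)y) - f(y) = (f(x) + f(1-x)) y^q` for all `x ∈ ]0, 1[` and `y ∈ ]0, 1]`. -/
def SatisfiesEntropyEquation (q : ℝ) (f : ℝ → ℝ) : Prop :=
  ∀ x ∈ Set.Ioo (0 : ℝ) 1, ∀ y ∈ Set.Ioc (0 : ℝ) 1,
    f (x * y) + f ((1 - x) * y) - f y = (f x + f (1 - x)) * y ^ q

/-- `E` is a Lebesgue measurable subset of `]0, 1[` of positive Lebesgue measure. -/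
def IsPositiveMeasureSubset (E : Set ℝ) : Prop :=
  E ⊆ Set.Ioo (0 : ℝ) 1 ∧ NullMeasurableSet E volume ∧ 0 < volume E

/-- The restriction of `f` to `]0, 1]` is Lebesgue measurable: preimages of Borel sets are
Lebesgue measurable (Mathlib calls sets of the completed σ-algebra null-measurable). -/
def LebesgueMeasurableOnUnit (f : ℝ → ℝ) : Prop :=
  ∀ s : Set ℝ, MeasurableSet s → NullMeasurableSet (Set.Ioc (0 : ℝ) 1 ∩ f ⁻¹' s) volume

/-!
Comparing the equation at scale `y` and at scale `l * y` shows that, for each `l ∈ ]0, 1]`, the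
function `u ↦ f (l * u) - l ^ q * f u` is additive on `]0, 1]`; it therefore extends to an additive
map `A_l : ℝ → ℝ` (`SatisfiesEntropyEquation.exists_addMonoidHom`), and `A_l 1 = f l` because
`f 1 = 0`.

If `q ≠ 1`, computing `f (x / 2)` through `A_x` and through `A_{1/2}` gives, with no regularity
assumption, `(1 / 2 - (1 / 2) ^ q) * f x = A_{1/2} x - x ^ q * A_{1/2} 1`. Hence `f` is the sum of
an additive map and a multiple of `x ^ q`
(`SatisfiesEntropyEquation.exists_eq_addMonoidHom_add_rpow`). An additive map that is bounded
above on a measurable set of positive measure is linear (`addMonoidHom_eq_mul_of_le`).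

If `q = 1` and `|f| ≤ M` on a compact set `K` of positive measure, then for `l` near `1` the set
of `x ∈ K` with `l * x ∈ K` still has positive measure, and `A_l ≤ 2 * M` there. So `A_l` is linear,
which reads `f (l * u) = l * f u + u * f l` for `l` near `1`; moreover `f` is bounded near `1`
(`SatisfiesEntropyEquation.exists_derivation_near_one`). Then `t ↦ exp t * f (exp (-t))` is additive
and bounded near `0`, hence linear, and `f` is a multiple of `x * log x`.

A measurable `f` is bounded on a set of positive measure, so the measurable cases reduce to the
bounded ones.
-/

open scoped Topology Pointwise

/-! ### Additive functions on the real line -/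

/-- A function additive on the triangle `u, v > 0`, `u + v ≤ 1` agrees on `]0, 1]` with an additive
map on `ℝ`, namely `x ↦ ⌊x⌋ * g 1 + g (fract x)`, where `g 0` is replaced by `0`. -/
lemma exists_addMonoidHom_eqOn_Ioc {g : ℝ → ℝ}
    (hg : ∀ u v, 0 < u → 0 < v → u + v ≤ 1 → g (u + v) = g u + g v) :
    ∃ A : ℝ →+ ℝ, ∀ u ∈ Set.Ioc (0 : ℝ) 1, A u = g u := by
  classical
  obtain ⟨h, h0, hpos⟩ : ∃ h : ℝ → ℝ, h 0 = 0 ∧ ∀ u, 0 < u → h u = g u :=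
    ⟨fun u => if u = 0 then 0 else g u, by simp, fun u hu => by simp [hu.ne']⟩
  have hadd : ∀ u v, 0 ≤ u → 0 ≤ v → u + v ≤ 1 → h (u + v) = h u + h v := by
    intro u v hu hv huv
    rcases hu.eq_or_lt with rfl | hu
    · simp [h0]
    rcases hv.eq_or_lt with rfl | hv
    · simp [h0]
    rw [hpos _ (by linarith), hpos u hu, hpos v hv, hg u v hu hv huv]
  have key : ∀ x y : ℝ, (⌊x + y⌋ : ℝ) * h 1 + h (Int.fract (x + y)) =
      ((⌊x⌋ : ℝ) * h 1 + h (Int.fract x)) + ((⌊y⌋ : ℝ) * h 1 + h (Int.fract y)) := by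
    intro x y
    have hx0 := Int.fract_nonneg x
    have hy0 := Int.fract_nonneg y
    have hx1 := Int.fract_lt_one x
    have hy1 := Int.fract_lt_one y
    have ex := Int.floor_add_fract x
    have ey := Int.floor_add_fract y
    rcases lt_or_ge (Int.fract x + Int.fract y) 1 with hlt | hge
    · have hfl : ⌊x + y⌋ = ⌊x⌋ + ⌊y⌋ := by
        rw [Int.floor_eq_iff]; push_cast; constructor <;> linarith
      have hfr : Int.fract (x + y) = Int.fract x + Int.fract y := by
        rw [Int.fract, hfl]; push_cast; linarith
      rw [hfr, hadd _ _ hx0 hy0 hlt.le, hfl]; push_cast; ring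
    · -- With a carry, compare `h (fract x)` and `h 1` through the complement `1 - fract y`.
      have hfl : ⌊x + y⌋ = ⌊x⌋ + ⌊y⌋ + 1 := by
        rw [Int.floor_eq_iff]; push_cast; constructor <;> linarith
      have hfr : Int.fract (x + y) = Int.fract x + Int.fract y - 1 := by
        rw [Int.fract, hfl]; push_cast; linarith
      have h1 := hadd (Int.fract x + Int.fract y - 1) (1 - Int.fract y)
        (by linarith) (by linarith) (by linarith)
      have h2 := hadd (Int.fract y) (1 - Int.fract y) hy0 (by linarith) (by linarith)
      rw [show Int.fract x + Int.fract y - 1 + (1 - Int.fract y) = Int.fract x by ring] at h1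
      rw [show Int.fract y + (1 - Int.fract y) = 1 by ring] at h2
      rw [hfr, hfl]; push_cast; linarith
  refine ⟨AddMonoidHom.mk' (fun x => (⌊x⌋ : ℝ) * h 1 + h (Int.fract x)) key, fun u hu => ?_⟩
  rcases hu.2.eq_or_lt with rfl | hu1
  · simp [h0, hpos]
  · have hfl : ⌊u⌋ = 0 := Int.floor_eq_zero_iff.2 ⟨hu.1.le, hu1⟩
    have hfr : Int.fract u = u := Int.fract_eq_self.2 ⟨hu.1.le, hu1⟩
    simp [hfl, hfr, hpos u hu.1]

lemma addMonoidHom_eq_mul_of_isBounded {A : ℝ →+ ℝ} {s : Set ℝ} (hs : s ∈ 𝓝 (0 : ℝ))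
    (hb : Bornology.IsBounded (A '' s)) (x : ℝ) : A x = A 1 * x := by
  have hc := A.continuous_of_isBounded_nhds_zero hs hb
  have := map_real_smul A hc x 1
  simpa [mul_comm] using this

/-- By Fubini, the measure of `E ∩ (c - E)`, integrated over `c`, is the square of the measure
of `E`. -/
lemma exists_pos_volume_inter_reflection {E : Set ℝ} (hE : MeasurableSet E)
    (hpos : 0 < volume E) :
    ∃ c : ℝ, 0 < volume (E ∩ (fun x => c - x) ⁻¹' E) := by
  by_contra! hcon
  have hmp := measurePreserving_add_prod (volume : Measure ℝ) (volume : Measure ℝ)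
  have hm : MeasurableSet {p : ℝ × ℝ | p.2 ∈ E ∧ p.1 - p.2 ∈ E} :=
    (measurable_snd hE).inter ((measurable_fst.sub measurable_snd) hE)
  have h1 : (volume.prod volume) {p : ℝ × ℝ | p.2 ∈ E ∧ p.1 - p.2 ∈ E} = 0 := by
    rw [Measure.measure_prod_null hm]
    exact Filter.Eventually.of_forall fun c => le_antisymm (hcon c) bot_le
  have h2 := hmp.measure_preimage hm.nullMeasurableSet
  have h3 : (fun z : ℝ × ℝ => (z.1 + z.2, z.2)) ⁻¹' {p : ℝ × ℝ | p.2 ∈ E ∧ p.1 - p.2 ∈ E}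
      = E ×ˢ E := by
    ext ⟨a, b⟩; simp [and_comm]
  rw [h1, h3, Measure.prod_prod] at h2
  simp [hpos.ne'] at h2

/-- On `E ∩ (c - E)` an upper bound for the additive map `A` also gives a lower bound, since
`A x = A c - A (c - x)`; by Steinhaus's theorem `A` is then bounded near `0`. -/
lemma addMonoidHom_eq_mul_of_le {A : ℝ →+ ℝ} {E : Set ℝ} (hE : MeasurableSet E)
    (hpos : 0 < volume E) {M : ℝ} (hM : ∀ x ∈ E, A x ≤ M) (x : ℝ) : A x = A 1 * x := by
  obtain ⟨c, hc⟩ := exists_pos_volume_inter_reflection hE hpos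
  set F := E ∩ (fun x => c - x) ⁻¹' E
  have hF : MeasurableSet F := hE.inter ((measurable_const.sub measurable_id) hE)
  have hlow : ∀ x ∈ F, A c - M ≤ A x := fun x hx => by
    have := hM _ hx.2
    rw [map_sub] at this
    linarith
  refine addMonoidHom_eq_mul_of_isBounded
    (Measure.sub_mem_nhds_zero_of_addHaar_pos volume F hF hc) ?_ x
  refine (Metric.isBounded_Icc (-(2 * M - A c)) (2 * M - A c)).subset ?_
  rintro _ ⟨_, ⟨a, ha, b, hb, rfl⟩, rfl⟩
  have h1 := hM a ha.1
  have h2 := hM b hb.1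
  have h3 := hlow a ha
  have h4 := hlow b hb
  simp only [map_sub, Set.mem_Icc]
  constructor <;> linarith

/-! ### Sets of positive measure -/

/-- For `l` near `1`, the sets `K` and `l • K` lie in a common open set of measure less than
`3 / 2 * volume K`, so they cannot be almost disjoint. -/
lemma eventually_pos_volume_inter_preimage_mul {K : Set ℝ} (hK : IsCompact K)
    (hpos : 0 < volume K) :
    ∀ᶠ l in 𝓝 (1 : ℝ), 0 < volume (K ∩ (fun x => l * x) ⁻¹' K) := by
  have hfin := hK.measure_lt_top (μ := volume)
  obtain ⟨U, hKU, hU, hlt⟩ := hK.exists_isOpen_lt_add (μ := volume)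
    (ε := volume K / 2) (ENNReal.half_pos hpos.ne').ne'
  have hsub : ∀ᶠ l in 𝓝 (1 : ℝ), ∀ x ∈ K, l * x ∈ U := by
    refine hK.eventually_forall_of_forall_eventually fun x hx => ?_
    have : Filter.Tendsto (fun p : ℝ × ℝ => p.1 * p.2) (𝓝 (1, x)) (𝓝 x) :=
      (continuous_fst.mul continuous_snd).tendsto' _ _ (by simp)
    exact this.eventually (hU.mem_nhds (hKU hx))
  filter_upwards [hsub, lt_mem_nhds (show (1 / 2 : ℝ) < 1 by norm_num)] with l hl hl2
  rw [pos_iff_ne_zero]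
  intro h0
  have h1 : volume (l • K ∩ K) = 0 := by
    refine measure_mono_null (t := l • (K ∩ (fun x => l * x) ⁻¹' K)) ?_ ?_
    · rintro _ ⟨⟨x, hx, rfl⟩, hlx⟩
      exact ⟨x, ⟨hx, hlx⟩, rfl⟩
    · rw [Measure.addHaar_smul, h0, mul_zero]
  have h2 := measure_union_add_inter (μ := volume) (l • K) hK.measurableSet
  have h3 : volume (l • K ∪ K) ≤ volume U := by
    refine measure_mono (Set.union_subset ?_ hKU)
    rintro _ ⟨x, hx, rfl⟩
    exact hl x hx
  have h4 : volume K / 2 ≤ volume (l • K) := by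
    rw [Measure.addHaar_smul, ENNReal.div_eq_inv_mul]
    gcongr
    rw [show (2 : ENNReal)⁻¹ = ENNReal.ofReal (1 / 2) by
      rw [one_div, ENNReal.ofReal_inv_of_pos two_pos]; simp]
    apply ENNReal.ofReal_le_ofReal
    simp only [Module.finrank_self, pow_one]
    exact hl2.le.trans (le_abs_self l)
  rw [h1, add_zero] at h2
  refine absurd (h3.trans_lt hlt) (not_lt.2 ?_)
  rw [h2, add_comm]
  gcongr

lemma IsPositiveMeasureSubset.exists_isCompact {E : Set ℝ} (hE : IsPositiveMeasureSubset E) :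
    ∃ K ⊆ E, IsCompact K ∧ 0 < volume K := by
  obtain ⟨-, hm, hpos⟩ := hE
  obtain ⟨T, hTE, hT, hae⟩ := hm.exists_measurable_subset_ae_eq
  rw [← measure_congr hae] at hpos
  obtain ⟨K, hKT, hK, hKpos⟩ := hT.exists_lt_isCompact hpos
  exact ⟨K, hKT.trans hTE, hK, hKpos⟩

lemma LebesgueMeasurableOnUnit.exists_bdd {f : ℝ → ℝ} (hf : LebesgueMeasurableOnUnit f) :
    ∃ E, IsPositiveMeasureSubset E ∧ BddAbove (f '' E) ∧ BddBelow (f '' E) := by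
  have hun : Set.Ioo (0 : ℝ) 1 = ⋃ n : ℕ, Set.Ioo 0 1 ∩ f ⁻¹' Set.Icc (-n : ℝ) n := by
    rw [← Set.inter_iUnion, eq_comm, Set.inter_eq_left]
    intro x _
    obtain ⟨n, hn⟩ := exists_nat_ge |f x|
    exact Set.mem_iUnion.2 ⟨n, abs_le.1 hn⟩
  obtain ⟨n, hn⟩ : ∃ n : ℕ, volume (Set.Ioo 0 1 ∩ f ⁻¹' Set.Icc (-n : ℝ) n) ≠ 0 := by
    by_contra! h
    have := measure_iUnion_null h
    rw [← hun] at this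
    simp at this
  refine ⟨_, ⟨Set.inter_subset_left, ?_, pos_iff_ne_zero.2 hn⟩, ⟨n, ?_⟩, ⟨-n, ?_⟩⟩
  · have := (hf _ (measurableSet_Icc (a := (-n : ℝ)) (b := n))).inter
      (measurableSet_Ioo (a := (0 : ℝ)) (b := 1)).nullMeasurableSet
    convert this using 1
    ext x
    exact ⟨fun h => ⟨⟨Set.Ioo_subset_Ioc_self h.1, h.2⟩, h.1⟩, fun h => ⟨h.2, h.1.2⟩⟩
  · rintro _ ⟨x, hx, rfl⟩
    exact hx.2.2
  · rintro _ ⟨x, hx, rfl⟩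
    exact hx.2.1

/-! ### The functional equation -/

namespace SatisfiesEntropyEquation

variable {q : ℝ} {f : ℝ → ℝ}

lemma map_one (hf : SatisfiesEntropyEquation q f) : f 1 = 0 := by
  have := hf (1 / 2) ⟨by norm_num, by norm_num⟩ 1 ⟨by norm_num, le_rfl⟩
  rw [Real.one_rpow] at this
  simp only [mul_one] at this
  linarith

/-- The failure of `f` to be homogeneous of degree `q` under scaling by `l` is additive: for
`u + v ≤ 1`, the equation at `x = u / (u + v)` and `y = u + v`, respectively `y = l * (u + v)`, has
right-hand sides in the ratio `l ^ q`. -/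
lemma exists_addMonoidHom (hf : SatisfiesEntropyEquation q f) {l : ℝ}
    (hl : l ∈ Set.Ioc (0 : ℝ) 1) :
    ∃ A : ℝ →+ ℝ, ∀ u ∈ Set.Ioc (0 : ℝ) 1, A u = f (l * u) - l ^ q * f u := by
  refine exists_addMonoidHom_eqOn_Ioc fun u v hu hv huv => ?_
  have hs : 0 < u + v := by linarith
  have hx : u / (u + v) ∈ Set.Ioo (0 : ℝ) 1 :=
    ⟨by positivity, by rw [div_lt_one hs]; linarith⟩
  have e1 := hf _ hx (u + v) ⟨hs, huv⟩
  have e2 := hf _ hx (l * (u + v))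
    ⟨mul_pos hl.1 hs, mul_le_one₀ hl.2 hs.le huv⟩
  rw [Real.mul_rpow hl.1.le hs.le] at e2
  have a1 : u / (u + v) * (u + v) = u := by field_simp
  have a2 : (1 - u / (u + v)) * (u + v) = v := by field_simp; ring
  have a3 : u / (u + v) * (l * (u + v)) = l * u := by field_simp
  have a4 : (1 - u / (u + v)) * (l * (u + v)) = l * v := by field_simp; ring
  rw [a1, a2] at e1
  rw [a3, a4] at e2
  linear_combination l ^ q * e1 - e2

/-- The general solution for `q ≠ 1`. -/
lemma exists_eq_addMonoidHom_add_rpow (hf : SatisfiesEntropyEquation q f) (hq : q ≠ 1) :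
    ∃ (B : ℝ →+ ℝ) (c : ℝ), ∀ x ∈ Set.Ioc (0 : ℝ) 1, f x = B x + c * x ^ q := by
  have hhalf : (1 / 2 : ℝ) ∈ Set.Ioc (0 : ℝ) 1 := ⟨by norm_num, by norm_num⟩
  obtain ⟨A, hA⟩ := hf.exists_addMonoidHom hhalf
  -- This is where `q ≠ 1` enters.
  have hd : (1 / 2 : ℝ) - (1 / 2) ^ q ≠ 0 := by
    intro h
    apply hq
    refine (Real.rpow_right_inj (x := 1 / 2) (by norm_num) (by norm_num)).1 ?_
    rw [Real.rpow_one]; linarith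
  refine ⟨(AddMonoidHom.mulLeft ((1 / 2 : ℝ) - (1 / 2) ^ q)⁻¹).comp A,
    -(((1 / 2 : ℝ) - (1 / 2) ^ q)⁻¹ * A 1), fun x hx => ?_⟩
  obtain ⟨C, hC⟩ := hf.exists_addMonoidHom hx
  have h1 : (1 : ℝ) ∈ Set.Ioc (0 : ℝ) 1 := ⟨one_pos, le_rfl⟩
  have c1 := hC 1 h1
  have c2 := hC (1 / 2) hhalf
  have a1 := hA 1 h1
  have a2 := hA x hx
  have hC2 : C 1 = C (1 / 2) + C (1 / 2) := by rw [← map_add]; norm_num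
  rw [hf.map_one, mul_one, mul_zero, sub_zero] at a1 c1
  rw [mul_comm x] at c2
  -- Evaluate `f (x / 2)` through both `C` and `A`; additivity gives `C (1 / 2) = f x / 2`.
  have key : ((1 / 2 : ℝ) - (1 / 2) ^ q) * f x = A x - x ^ q * A 1 := by
    linear_combination (-1/2) * c1 + c2 - a2 + x ^ q * a1 + (1/2) * hC2
  simp only [AddMonoidHom.coe_comp, Function.comp_apply, AddMonoidHom.coe_mulLeft]
  rw [← inv_mul_cancel_left₀ hd (f x), key]
  ring

lemma exists_eq_rpow (hf : SatisfiesEntropyEquation q f) (hq : q ≠ 1) {E : Set ℝ}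
    (hE : IsPositiveMeasureSubset E) (hb : BddAbove (f '' E) ∨ BddBelow (f '' E)) :
    ∃ c cstar : ℝ, ∀ x ∈ Set.Ioo (0 : ℝ) 1, f x = cstar * x + c * x ^ q := by
  obtain ⟨B, c, hB⟩ := hf.exists_eq_addMonoidHom_add_rpow hq
  obtain ⟨K, hKE, hK, hKpos⟩ := hE.exists_isCompact
  have hKI : ∀ x ∈ K, x ∈ Set.Ioc (0 : ℝ) 1 := fun x hx =>
    Set.Ioo_subset_Ioc_self (hE.1 (hKE hx))
  have hcont : ContinuousOn (fun x : ℝ => c * x ^ q) K := fun x hx =>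
    ((Real.continuousAt_rpow_const x q (.inl (hKI x hx).1.ne')).const_mul c).continuousWithinAt
  obtain ⟨N, hN⟩ := hK.exists_bound_of_continuousOn hcont
  suffices h : ∀ x, B x = B 1 * x from
    ⟨c, B 1, fun x hx => by rw [hB x (Set.Ioo_subset_Ioc_self hx), h x]⟩
  rcases hb with ⟨M, hM⟩ | ⟨M, hM⟩
  · refine addMonoidHom_eq_mul_of_le hK.measurableSet hKpos (M := M + N) fun x hx => ?_
    have h1 := hM ⟨x, hKE hx, rfl⟩
    have h2 := abs_le.1 (hN x hx)
    have h3 := hB x (hKI x hx)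
    linarith [h2.1]
  · have := addMonoidHom_eq_mul_of_le (A := -B) hK.measurableSet hKpos (M := -M + N)
      fun x hx => by
        have h1 := hM ⟨x, hKE hx, rfl⟩
        have h2 := abs_le.1 (hN x hx)
        have h3 := hB x (hKI x hx)
        rw [AddMonoidHom.neg_apply]
        linarith [h2.2]
    intro x
    have := this x
    simp only [AddMonoidHom.neg_apply] at this
    linarith

/-- For `q = 1` the function `f` satisfies the Leibniz rule for multiplication by numbers close
to `1`, and is bounded near `1`. -/
lemma exists_derivation_near_one (hf : SatisfiesEntropyEquation 1 f) {E : Set ℝ}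
    (hE : IsPositiveMeasureSubset E) (ha : BddAbove (f '' E)) (hb : BddBelow (f '' E)) :
    ∃ δ > 0, ∃ C : ℝ, ∀ l ∈ Set.Ioc (1 - δ) 1, 0 < l ∧ |f l| ≤ C ∧
      ∀ u ∈ Set.Ioc (0 : ℝ) 1, f (l * u) = l * f u + u * f l := by
  obtain ⟨K, hKE, hK, hKpos⟩ := hE.exists_isCompact
  have hKI : ∀ x ∈ K, x ∈ Set.Ioc (0 : ℝ) 1 := fun x hx =>
    Set.Ioo_subset_Ioc_self (hE.1 (hKE hx))
  obtain ⟨M, hM⟩ : ∃ M, ∀ x ∈ K, |f x| ≤ M := by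
    obtain ⟨M, hM⟩ := ha
    obtain ⟨m, hm⟩ := hb
    refine ⟨max M (-m), fun x hx => abs_le.2 ⟨?_, ?_⟩⟩
    · have := hm ⟨x, hKE hx, rfl⟩
      linarith [le_max_right M (-m)]
    · exact (hM ⟨x, hKE hx, rfl⟩).trans (le_max_left _ _)
  obtain ⟨e, he, hKe⟩ : ∃ e > 0, ∀ x ∈ K, e ≤ x := by
    obtain ⟨e, he, hmin⟩ := hK.exists_isMinOn (nonempty_of_measure_ne_zero hKpos.ne')
      continuousOn_id
    exact ⟨e, (hKI e he).1, fun x hx => hmin hx⟩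
  obtain ⟨δ, hδ, hball⟩ := Metric.eventually_nhds_iff.1
    ((eventually_pos_volume_inter_preimage_mul hK hKpos).and (lt_mem_nhds one_pos))
  refine ⟨δ, hδ, 2 * M / e, fun l hl => ?_⟩
  obtain ⟨hvol, hl0⟩ := hball (y := l) (by
    rw [Real.dist_eq, abs_lt]; constructor <;> linarith [hl.1, hl.2])
  have hlI : l ∈ Set.Ioc (0 : ℝ) 1 := ⟨hl0, hl.2⟩
  obtain ⟨A, hA⟩ := hf.exists_addMonoidHom hlI
  simp only [Real.rpow_one] at hA
  have hlin : ∀ x, A x = A 1 * x := by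
    refine addMonoidHom_eq_mul_of_le
      (hK.measurableSet.inter ((measurable_const_mul l) hK.measurableSet)) hvol (M := 2 * M) ?_
    intro x hx
    rw [hA x (hKI x hx.1)]
    have h1 := abs_le.1 (hM _ hx.1)
    have h2 := (abs_le.1 (hM _ hx.2)).2
    nlinarith [hl.2]
  have hA1 : A 1 = f l := by
    rw [hA 1 ⟨one_pos, le_rfl⟩, hf.map_one]; simp
  have hder : ∀ u ∈ Set.Ioc (0 : ℝ) 1, f (l * u) = l * f u + u * f l := fun u hu => by
    have h1 := hA u hu
    rw [hlin, hA1] at h1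
    linarith
  refine ⟨hl0, ?_, hder⟩
  -- `x * f l = f (l * x) - l * f x` with `x` and `l * x` in `K` bounds `f l`.
  obtain ⟨x, hx⟩ := nonempty_of_measure_ne_zero hvol.ne'
  have h1 := abs_le.1 (hM _ hx.1)
  have h2 := abs_le.1 (hM _ hx.2)
  simp only [hder x (hKI x hx.1)] at h2
  have h3 : x * |f l| ≤ 2 * M := by
    have : x * |f l| = |x * f l| := by rw [abs_mul, abs_of_pos (hKI x hx.1).1]
    rw [this, abs_le]
    constructor <;> nlinarith [hl.2]
  rw [le_div_iff₀ he]
  nlinarith [hKe x hx.1, abs_nonneg (f l)]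

lemma exists_eq_mul_log (hf : SatisfiesEntropyEquation 1 f) {E : Set ℝ}
    (hE : IsPositiveMeasureSubset E) (ha : BddAbove (f '' E)) (hb : BddBelow (f '' E)) :
    ∃ c : ℝ, ∀ x ∈ Set.Ioc (0 : ℝ) 1, f x = c * x * Real.log x := by
  obtain ⟨δ, hδ, C, hC⟩ := hf.exists_derivation_near_one hE ha hb
  -- `L` turns the Leibniz rule into additivity.
  obtain ⟨L, hL⟩ : ∃ L : ℝ → ℝ, ∀ t, L t = Real.exp t * f (Real.exp (-t)) := ⟨_, fun _ => rfl⟩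
  have hC0 : 0 ≤ C := (abs_nonneg _).trans (hC 1 ⟨by linarith, le_rfl⟩).2.1
  obtain ⟨r, hr, hrI⟩ : ∃ r > 0, ∀ s ∈ Set.Icc 0 r, Real.exp (-s) ∈ Set.Ioc (1 - δ) 1 := by
    refine ⟨δ / 2, by positivity, fun s hs => ⟨?_, Real.exp_le_one_iff.2 (by linarith [hs.1])⟩⟩
    linarith [Real.add_one_le_exp (-s), hs.2]
  have hadd : ∀ s ∈ Set.Icc 0 r, ∀ t, 0 ≤ t → L (s + t) = L s + L t := by
    intro s hs t ht
    have h1 := (hC _ (hrI s hs)).2.2 (Real.exp (-t))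
      ⟨Real.exp_pos _, Real.exp_le_one_iff.2 (by linarith)⟩
    rw [← Real.exp_add, ← neg_add] at h1
    rw [hL, hL, hL, h1, Real.exp_add, Real.exp_neg, Real.exp_neg]
    field_simp
    ring
  have hnsmul : ∀ s ∈ Set.Icc 0 r, ∀ n : ℕ, L (n * s) = n * L s := by
    intro s hs n
    induction n with
    | zero => simp [hL, hf.map_one]
    | succ n ih =>
      have := hadd s hs (n * s) (mul_nonneg n.cast_nonneg hs.1)
      push_cast
      rw [show ((n : ℝ) + 1) * s = s + n * s by ring, this, ih]; ring
  have hbound : ∀ s ∈ Set.Icc 0 r, |L s| ≤ Real.exp r * C := by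
    intro s hs
    rw [hL, abs_mul, Real.abs_exp]
    gcongr
    · exact hs.2
    · exact (hC _ (hrI s hs)).2.1
  -- `L` is additive on `[0, r]`, so its rescaling to `]0, 1]` extends to `ℝ`.
  obtain ⟨A, hA⟩ := exists_addMonoidHom_eqOn_Ioc (g := fun t => L (r * t)) (by
    intro u v hu hv huv
    simp only [mul_add]
    exact hadd _ ⟨by positivity, by nlinarith⟩ _ (by positivity))
  have hIcc : ∀ t ∈ Set.Ioc (0 : ℝ) 1, r * t ∈ Set.Icc 0 r := fun t ht =>
    ⟨mul_nonneg hr.le ht.1.le, by nlinarith [ht.2]⟩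
  have hAb : ∀ t ∈ Set.Ioc (0 : ℝ) 1, |A t| ≤ Real.exp r * C := fun t ht => by
    rw [hA t ht]; exact hbound _ (hIcc t ht)
  have hlin : ∀ t, A t = A 1 * t := by
    have hmem : Set.Icc (-1 : ℝ) 1 ∈ 𝓝 0 := Icc_mem_nhds (by norm_num) one_pos
    refine addMonoidHom_eq_mul_of_isBounded hmem
      ((Metric.isBounded_Icc (-(Real.exp r * C)) (Real.exp r * C)).subset ?_)
    rintro _ ⟨t, ht, rfl⟩
    rw [Set.mem_Icc, ← abs_le]
    rcases lt_trichotomy t 0 with h | rfl | h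
    · rw [← abs_neg, ← map_neg]
      exact hAb _ ⟨by linarith, by linarith [ht.1]⟩
    · simp only [map_zero, abs_zero]; positivity
    · exact hAb _ ⟨h, ht.2⟩
  refine ⟨-(A 1 / r), fun x hx => ?_⟩
  have ht : 0 ≤ -Real.log x := neg_nonneg.2 (Real.log_nonpos hx.1.le hx.2)
  rcases ht.eq_or_lt with h0 | ht
  · have : x = 1 := Real.eq_one_of_pos_of_log_eq_zero hx.1 (by linarith)
    simp [this, hf.map_one]
  -- Divide `-log x` by a large `n` to land in `[0, r]`, where `L` is known to be linear.
  obtain ⟨n, hn⟩ := exists_nat_gt (-Real.log x / r)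
  have hx0 := hx.1
  have hn0 : (0 : ℝ) < n := (div_pos ht hr).trans hn
  have hs : -Real.log x / (r * n) ∈ Set.Ioc (0 : ℝ) 1 := by
    refine ⟨by positivity, ?_⟩
    rw [← div_div, div_le_one hn0]
    exact hn.le
  have h1 := hnsmul _ (hIcc _ hs) n
  have h2 := hA _ hs
  rw [show (n : ℝ) * (r * (-Real.log x / (r * n))) = -Real.log x by field_simp, ← h2, hlin, hL,
    neg_neg, Real.exp_log hx.1, Real.exp_neg, Real.exp_log hx.1] at h1
  field_simp at h1 ⊢
  linarith

end SatisfiesEntropyEquation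

theorem corollary2p1 (q : ℝ) (f : ℝ → ℝ) (hf : SatisfiesEntropyEquation q f) :
    (q ≠ 1 →
      ((∃ E : Set ℝ, IsPositiveMeasureSubset E ∧ (BddAbove (f '' E) ∨ BddBelow (f '' E))) ∨
        LebesgueMeasurableOnUnit f) →
      ∃ c cstar : ℝ,
        (∀ x ∈ Set.Ioo (0 : ℝ) 1, f x = cstar * x + c * x ^ q) ∧ f 1 = 0) ∧
    (q = 1 →
      ((∃ E : Set ℝ, IsPositiveMeasureSubset E ∧ BddAbove (f '' E) ∧ BddBelow (f '' E)) ∨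
        LebesgueMeasurableOnUnit f) →
      ∃ c cstar : ℝ,
        (∀ x ∈ Set.Ioo (0 : ℝ) 1, f x = c * x * Real.log x + cstar * x) ∧ f 1 = 0) := by
  refine ⟨fun hq h => ?_, ?_⟩
  · obtain ⟨E, hE, hb⟩ : ∃ E, IsPositiveMeasureSubset E ∧
        (BddAbove (f '' E) ∨ BddBelow (f '' E)) := by
      rcases h with h | h
      · exact h
      · obtain ⟨E, hE, ha, -⟩ := h.exists_bdd
        exact ⟨E, hE, .inl ha⟩
    obtain ⟨c, cstar, h⟩ := hf.exists_eq_rpow hq hE hb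
    exact ⟨c, cstar, h, hf.map_one⟩
  · rintro rfl h
    obtain ⟨E, hE, ha, hb⟩ := h.elim id fun h => h.exists_bdd
    obtain ⟨c, h⟩ := hf.exists_eq_mul_log hE ha hb
    refine ⟨c, 0, fun x hx => ?_, hf.map_one⟩
    rw [h x (Set.Ioo_subset_Ioc_self hx), zero_mul, add_zero]
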